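/- Let $T\in\mathbb{N}$, let $(\Omega,\mathcal{F},\mathbb{F}=(\mathcal{F}_t)_{t=0,\dots,T},\mathbb{P})$ be a filtered probability space, and write $\mathbb{I}=\{0,1,\dots,T\}$. A process is a family $(X_t)_{t\in\mathbb{I}}$ of $\mathcal{F}$-measurable real random variables, not necessarily adapted. Pointwise properties of processes (nonnegativity, strict positivity, initial values, zeros) are understood $\mathbb{P}$-a.s., and processes that agree $\mathbb{P}$-a.s. are identified for membership in a set of processes. A *market* is a set $\mathcal{X}$ of nonnegative processes such that every $X\in\mathcal{X}$ satisfies $X_0=1$ and stays at zero once it hits zero ($X_s=0$ implies $X_t=0$ for all $t\ge s$). It is *$\mathbb{F}$-adapted* if $X_t$ is $\mathcal{F}_t$-measurable for all $X\in\mathcal{X}$ and $t\in\mathbb{I}$. It satisfies *generalized fork convexity* if 1. $\lambda X^1+(1-\lambda)X^2\in\mathcal{X}$ for all $X^1,X^2\in\mathcal{X}$ and $\lambda\in[0,1]$; and 2. for all $X^1,X^2,X^3\in\mathcal{X}$, $s\in\mathbb{I}$ and $A\in\mathcal{F}_s$, the process that equals $X^1_t$ for $t<s$, and for $t\ge s$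 equals $$\mathbf 1_A\Big(\tfrac{X^2_t}{X^2_s}X^1_s\mathbf 1_{\{X^2_s>0\}}+X^1_t\mathbf 1_{\{X^2_s=0\}}\Big)+\mathbf 1_{A^c}\Big(\tfrac{X^3_t}{X^3_s}X^1_s\mathbf 1_{\{X^3_s>0\}}+X^1_t\mathbf 1_{\{X^3_s=0\}}\Big),$$ belongs to $\mathcal{X}$. The condition $\mathrm{NUPBR}_t$ says that $\mathcal{C}_t=\{X_t:X\in\mathcal{X}\}$ is bounded in probability, i.e. $\lim_{M\to\infty}\sup_{X\in\mathcal{X}}\mathbb{P}[|X_t|\ge M]=0$. A *generalized supermartingale deflator* for $\mathcal{X}$ is a nonnegative process $Z$ with $Z_0\le 1$ such that $$\mathbb{E}\Big[\tfrac{X_tZ_t}{X_sZ_s}\,\Big|\,\mathcal{F}_s\Big]\le 1\quad\text{a.s. for all }X\in\mathcal{X}\text{ and all } s\le t\text{ in }\mathbb{I},$$ with the convention $0/0=0$ (and $c/0=\infty$ for $c>0$). When $\mathcal{X}$ is $\mathbb{F}$-adapted, such a $Z$ is called a *supermartingale deflator* if it is moreover $\mathbb{F}$-adapted. **Theorem.**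 Let $\mathcal{X}$ be a market that satisfies generalized fork convexity. Then $\mathrm{NUPBR}_t$ holds for every $t\in\mathbb{I}$ if and only if there exists a strictly positive generalized supermartingale deflator for $\mathcal{X}$. If in addition $\mathcal{X}$ is $\mathbb{F}$-adapted, then $\mathrm{NUPBR}_t$ holds for every $t\in\mathbb{I}$ if and only if there exists a strictly positive supermartingale deflator for $\mathcal{X}$. -/

import Mathlib

open MeasureTheory Filter Topology
open scoped ENNReal

namespace DiscreteMarket

variable {Ω : Type*} [mΩ : MeasurableSpace Ω] {T : ℕ}

/-- A nonnegative stochastic process on `{0, 1, …, T}`: a family of random variables that are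
almost surely nonnegative. -/
structure IsNonnegProcess (P : Measure Ω) (Y : Fin (T + 1) → Ω → ℝ) : Prop where
  measurable : ∀ t, Measurable (Y t)
  nonneg : ∀ t, ∀ᵐ ω ∂P, 0 ≤ Y t ω

/-- A process is strictly positive if each of its values is almost surely positive. -/
def IsStrictlyPositive (P : Measure Ω) (Y : Fin (T + 1) → Ω → ℝ) : Prop :=
  ∀ t, ∀ᵐ ω ∂P, 0 < Y t ω

/-- A wealth process set, or market: nonnegative processes which start at `1` and which vanish
from their first zero on. -/
structure IsMarket (P : Measure Ω) (𝒳 : Set (Fin (T + 1) → Ω → ℝ)) : Prop where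
  process : ∀ X ∈ 𝒳, IsNonnegProcess P X
  initial : ∀ X ∈ 𝒳, ∀ᵐ ω ∂P, X 0 ω = 1
  vanish : ∀ X ∈ 𝒳, ∀ᵐ ω ∂P, ∀ s t, s ≤ t → X s ω = 0 → X t ω = 0

/-- `Y` belongs to `𝒳`, where processes that agree almost surely are identified. -/
def MemAE (P : Measure Ω) (𝒳 : Set (Fin (T + 1) → Ω → ℝ)) (Y : Fin (T + 1) → Ω → ℝ) : Prop :=
  ∃ X ∈ 𝒳, ∀ t, X t =ᵐ[P] Y t

open Classical in
/-- The wealth of an agent who holds `X₁` and at time `s` switches to `X₂` on `A` and to `X₃` off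
`A`, where the switch takes place only if the new asset is positive at time `s`. -/
noncomputable def switch (X₁ X₂ X₃ : Fin (T + 1) → Ω → ℝ) (s : Fin (T + 1)) (A : Set Ω) :
    Fin (T + 1) → Ω → ℝ := fun t ω =>
  if t < s then X₁ t ω
  else if ω ∈ A then (if 0 < X₂ s ω then X₂ t ω / X₂ s ω * X₁ s ω else X₁ t ω)
  else (if 0 < X₃ s ω then X₃ t ω / X₃ s ω * X₁ s ω else X₁ t ω)

/-- Generalized fork convexity. -/
structure GeneralizedForkConvex (P : Measure Ω) (ℱ : Filtration (Fin (T + 1)) mΩ)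
    (𝒳 : Set (Fin (T + 1) → Ω → ℝ)) : Prop where
  convex : ∀ X₁ ∈ 𝒳, ∀ X₂ ∈ 𝒳, ∀ c : ℝ, 0 ≤ c → c ≤ 1 → MemAE P 𝒳 (c • X₁ + (1 - c) • X₂)
  switch_mem : ∀ X₁ ∈ 𝒳, ∀ X₂ ∈ 𝒳, ∀ X₃ ∈ 𝒳, ∀ (s : Fin (T + 1)) (A : Set Ω),
    MeasurableSet[ℱ s] A → MemAE P 𝒳 (switch X₁ X₂ X₃ s A)

/-- A market is adapted if all its wealth processes are. -/
def IsAdaptedMarket (ℱ : Filtration (Fin (T + 1)) mΩ) (𝒳 : Set (Fin (T + 1) → Ω → ℝ)) : Prop :=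
  ∀ X ∈ 𝒳, Adapted ℱ X

/-- The set of values of the wealth processes at time `t`. -/
def valueSet (𝒳 : Set (Fin (T + 1) → Ω → ℝ)) (t : Fin (T + 1)) : Set (Ω → ℝ) :=
  (fun X => X t) '' 𝒳

/-- Boundedness in probability of a set of random variables. -/
def BoundedInProbability (P : Measure Ω) (C : Set (Ω → ℝ)) : Prop :=
  Tendsto (fun M : ℝ => ⨆ f ∈ C, P {ω | M ≤ |f ω|}) atTop (𝓝 0)

/-- No unbounded profit with bounded risk at time `t`. -/
def NUPBR (P : Measure Ω) (𝒳 : Set (Fin (T + 1) → Ω → ℝ)) (t : Fin (T + 1)) : Prop :=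
  BoundedInProbability P (valueSet 𝒳 t)

/-- A generalized supermartingale: a nonnegative process `Y` with `E[Y_t / Y_s | ℱ_s] ≤ 1` for
`s ≤ t`. The quotient is taken in `[0, ∞]`, where `0 / 0 = 0`, and `c / 0 = ∞` for `c > 0`. -/
structure IsGeneralizedSupermartingale (P : Measure Ω) (ℱ : Filtration (Fin (T + 1)) mΩ)
    (Y : Fin (T + 1) → Ω → ℝ) : Prop where
  process : IsNonnegProcess P Y
  condLExp_le : ∀ s t, s ≤ t →
    P⁻[fun ω => ENNReal.ofReal (Y t ω) / ENNReal.ofReal (Y s ω) | ℱ s] ≤ᵐ[P] 1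

/-- A generalized supermartingale deflator for the market `𝒳`. -/
structure IsGeneralizedSupermartingaleDeflator (P : Measure Ω)
    (ℱ : Filtration (Fin (T + 1)) mΩ) (𝒳 : Set (Fin (T + 1) → Ω → ℝ))
    (Z : Fin (T + 1) → Ω → ℝ) : Prop where
  process : IsNonnegProcess P Z
  initial : ∀ᵐ ω ∂P, Z 0 ω ≤ 1
  supermartingale : ∀ X ∈ 𝒳, IsGeneralizedSupermartingale P ℱ (Z * X)

/-- A supermartingale deflator (for an adapted market): an adapted generalized one. -/
structure IsSupermartingaleDeflator (P : Measure Ω)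
    (ℱ : Filtration (Fin (T + 1)) mΩ) (𝒳 : Set (Fin (T + 1) → Ω → ℝ))
    (Z : Fin (T + 1) → Ω → ℝ) : Prop extends
    IsGeneralizedSupermartingaleDeflator P ℱ 𝒳 Z where
  adapted : Adapted ℱ Z

end DiscreteMarket

/-! ### Bounded concave approximations of the logarithm and their near-maximisers. -/

namespace DiscreteMarket

/-! The deflator is the reciprocal of a log-optimal wealth process. Maximising `E[log X]` over a
convex set gives the first order condition `E[Y / X] ≤ 1` for every competitor `Y`. Since `log` need
not be integrable and no maximiser need lie in the market, `log` is replaced by the bounded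
functions `boundedLog a b`, whose near-maximisers satisfy a truncated first order condition up to a
small error (`exists_forall_integral_boundedLogDeriv_le`). The sets of processes satisfying these
conditions are nested and stable under midpoints, and NUPBR at every date lets
`exists_forall_mem_ae_tendsto` extract from them a sequence `g n` converging a.s. at all dates at
once. Fatou then yields the exact condition for the limit (`IsMarket.exists_numeraire`).

Optimality at the terminal date would say nothing on paths where every wealth process has died
earlier. It is therefore imposed at the lifetime `τ` of the market (`IsMarket.exists_lifetime`), a
random time that need not be a stopping time.

Write `L` for the limit. To pass from `E[Y_τ / L_τ] ≤ 1` to conditional statements, fork convexity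
supplies the process that follows `g n`, holds `X` from `s` to `t` on `A ∈ ℱ s`, and then returns to
`g n`. Its value at `τ`, divided by `L_τ`, becomes in the limit `(X_t / L_t) / (X_s / L_s)` on `A ∩
{t ≤ τ}` and `1` off `A`; for `τ < t` one has `X_t = 0`. Hence the integral of that ratio over `A`
is at most `P A` for every such `A`, which is the deflator property of `1 / L`. A limit of adapted
processes is adapted, so the adapted case needs no further construction.

Conversely, a positive deflator bounds `E[Z_t X_t / Z_0]` by `1` uniformly in `X`, and Markov's
inequality gives NUPBR. -/

/-- The function `log (x + a) - log (x + b)`, which for `0 < a ≤ b` is bounded, increasing and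
concave on `[0, ∞)`. -/
noncomputable def boundedLog (a b x : ℝ) : ℝ := Real.log (x + a) - Real.log (x + b)

/-- The derivative of `boundedLog a b`. -/
noncomputable def boundedLogDeriv (a b x : ℝ) : ℝ := (x + a)⁻¹ - (x + b)⁻¹

section boundedLog

variable {a b x y : ℝ}

lemma boundedLogDeriv_eq (ha : 0 < a) (hab : a ≤ b) (hx : 0 ≤ x) :
    boundedLogDeriv a b x = (b - a) / ((x + a) * (x + b)) := by
  have h1 : x + a ≠ 0 := by positivity
  have h2 : x + b ≠ 0 := by linarith
  unfold boundedLogDeriv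
  field_simp
  ring

lemma boundedLogDeriv_nonneg (ha : 0 < a) (hab : a ≤ b) (hx : 0 ≤ x) :
    0 ≤ boundedLogDeriv a b x := by
  have : (x + b)⁻¹ ≤ (x + a)⁻¹ := inv_anti₀ (by positivity) (by linarith)
  unfold boundedLogDeriv
  linarith

lemma boundedLogDeriv_le_inv (ha : 0 < a) (hab : a ≤ b) (hx : 0 ≤ x) :
    boundedLogDeriv a b x ≤ a⁻¹ := by
  have h1 : (x + a)⁻¹ ≤ a⁻¹ := inv_anti₀ ha (by linarith)
  have h2 : 0 ≤ (x + b)⁻¹ := inv_nonneg.2 (by linarith)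
  unfold boundedLogDeriv
  linarith

lemma mul_boundedLogDeriv_le_one (ha : 0 < a) (hab : a ≤ b) (hx : 0 ≤ x) :
    x * boundedLogDeriv a b x ≤ 1 := by
  have h1 : x * (x + a)⁻¹ ≤ 1 := by
    rw [← div_eq_mul_inv, div_le_one (by positivity)]
    linarith
  have h2 : 0 ≤ x * (x + b)⁻¹ := mul_nonneg hx (inv_nonneg.2 (by linarith))
  unfold boundedLogDeriv
  linarith

lemma boundedLogDeriv_anti (ha : 0 < a) (hab : a ≤ b) (hx : 0 ≤ x) (hxy : x ≤ y) :
    boundedLogDeriv a b y ≤ boundedLogDeriv a b x := by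
  have hy := hx.trans hxy
  rw [boundedLogDeriv_eq ha hab hx, boundedLogDeriv_eq ha hab hy]
  have : 0 ≤ b - a := by linarith
  have : 0 < b := by linarith
  gcongr

/-- Only an upper bound on `y` is needed because the derivative is decreasing; `1 / a ^ 2` is a
Lipschitz constant of `x ↦ (x + a)⁻¹` on the half-line. -/
lemma boundedLogDeriv_sub_le (ha : 0 < a) (hab : a ≤ b) (hx : 0 ≤ x) {d : ℝ} (hd : 0 ≤ d)
    (hy : 0 ≤ y) (hyx : y ≤ x + d) :
    boundedLogDeriv a b x - d / a ^ 2 ≤ boundedLogDeriv a b y := by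
  refine le_trans ?_ (boundedLogDeriv_anti ha hab hy hyx)
  have h1 : (x + d + b)⁻¹ ≤ (x + b)⁻¹ := inv_anti₀ (by linarith) (by linarith)
  have h2 : (x + a)⁻¹ - (x + d + a)⁻¹ ≤ d / a ^ 2 := by
    have e : (x + a)⁻¹ - (x + d + a)⁻¹ = d / ((x + a) * (x + d + a)) := by
      have h1 : x + a ≠ 0 := by positivity
      have h2 : x + d + a ≠ 0 := by positivity
      field_simp
      ring
    rw [e, sq]
    gcongr <;> linarith
  unfold boundedLogDeriv
  linarith

/-- This makes the truncated first order conditions more demanding as `a` decreases and `b` grows,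
hence nested. -/
lemma boundedLogDeriv_mono {a' b' : ℝ} (ha' : 0 < a') (haa : a' ≤ a) (hb : 0 < b) (hbb : b ≤ b')
    (hx : 0 ≤ x) : boundedLogDeriv a b x ≤ boundedLogDeriv a' b' x := by
  unfold boundedLogDeriv
  gcongr

/-- The convexity gap of `(x + c)⁻¹` at a midpoint has an explicit form that decreases in `c`, so
the gap for `a` dominates the one for `b`. This is what makes the first order conditions stable
under midpoints. -/
lemma boundedLogDeriv_midpoint (ha : 0 < a) (hab : a ≤ b) (hx : 0 ≤ x) (hy : 0 ≤ y) :
    boundedLogDeriv a b ((x + y) / 2) ≤ (boundedLogDeriv a b x + boundedLogDeriv a b y) / 2 := by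
  have e (c : ℝ) (hc : 0 < c) : ((x + c)⁻¹ + (y + c)⁻¹) / 2 - ((x + y) / 2 + c)⁻¹ =
      (x - y) ^ 2 / (2 * ((x + c) * (y + c) * (x + y + 2 * c))) := by
    have h1 : x + c ≠ 0 := by positivity
    have h2 : y + c ≠ 0 := by positivity
    have h3 : (x + y) / 2 + c ≠ 0 := by positivity
    have h4 : x + y + 2 * c ≠ 0 := by positivity
    have h5 : ((x + y) / 2 + c)⁻¹ = 2 * (x + y + 2 * c)⁻¹ := by
      field_simp
    rw [h5]
    field_simp
    ring
  have hb : 0 < b := by linarith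
  have h1 := e a ha
  have h2 := e b hb
  have h3 : (x - y) ^ 2 / (2 * ((x + b) * (y + b) * (x + y + 2 * b))) ≤
      (x - y) ^ 2 / (2 * ((x + a) * (y + a) * (x + y + 2 * a))) := by
    gcongr
  unfold boundedLogDeriv
  linarith

lemma boundedLog_nonpos (ha : 0 < a) (hab : a ≤ b) (hx : 0 ≤ x) : boundedLog a b x ≤ 0 :=
  sub_nonpos.2 (Real.log_le_log (by positivity) (by linarith))

/-- Concavity in tangent form: after `log u ≥ 1 - 1 / u`, what remains is a square times `b - a`. -/
lemma sub_mul_boundedLogDeriv_le (ha : 0 < a) (hab : a ≤ b) (hx : 0 ≤ x) (hy : 0 ≤ y) :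
    (y - x) * boundedLogDeriv a b y ≤ boundedLog a b y - boundedLog a b x := by
  have hb : 0 < b := by linarith
  have h1 : 0 < x + a := by positivity
  have h2 : 0 < y + a := by positivity
  have h3 : 0 < x + b := by positivity
  have h4 : 0 < y + b := by positivity
  have e : boundedLog a b y - boundedLog a b x
      = Real.log ((y + a) * (x + b) / ((x + a) * (y + b))) := by
    rw [Real.log_div (by positivity) (by positivity), Real.log_mul h2.ne' h3.ne',
      Real.log_mul h1.ne' h4.ne']
    unfold boundedLog
    ring
  rw [e]
  refine le_trans ?_ (Real.one_sub_inv_le_log_of_pos (by positivity))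
  rw [boundedLogDeriv_eq ha hab hy, inv_div]
  have e2 : 1 - (x + a) * (y + b) / ((y + a) * (x + b)) - (y - x) * ((b - a) / ((y + a) * (y + b)))
      = (y - x) ^ 2 * (b - a) / ((y + a) * (x + b) * (y + b)) := by
    field_simp
    ring
  have : 0 ≤ (y - x) ^ 2 * (b - a) / ((y + a) * (x + b) * (y + b)) :=
    div_nonneg (mul_nonneg (sq_nonneg _) (by linarith)) (by positivity)
  linarith

lemma boundedLog_mono (ha : 0 < a) (hab : a ≤ b) (hx : 0 ≤ x) (hxy : x ≤ y) :
    boundedLog a b x ≤ boundedLog a b y := by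
  have h1 := sub_mul_boundedLogDeriv_le ha hab hx (hx.trans hxy)
  have h2 := mul_nonneg (sub_nonneg.2 hxy) (boundedLogDeriv_nonneg ha hab (hx.trans hxy))
  linarith

lemma abs_boundedLog_le (ha : 0 < a) (hab : a ≤ b) (hx : 0 ≤ x) :
    |boundedLog a b x| ≤ |boundedLog a b 0| := by
  have h1 := boundedLog_nonpos ha hab hx
  have h2 := boundedLog_mono ha hab le_rfl hx
  rw [abs_of_nonpos h1, abs_of_nonpos (h2.trans h1)]
  linarith

lemma measurable_boundedLog : Measurable (boundedLog a b) := by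
  unfold boundedLog
  fun_prop

lemma measurable_boundedLogDeriv : Measurable (boundedLogDeriv a b) := by
  unfold boundedLogDeriv
  fun_prop

/-- The first order condition for the maximisation of `boundedLog a b`, up to an error which comes
from moving away from `g` with step `c`. -/
lemma min_mul_boundedLogDeriv_le (ha : 0 < a) (hab : a ≤ b) {f g M c : ℝ} (hf : 0 ≤ f) (hg : 0 ≤ g)
    (hM : 0 ≤ M) (hc : 0 < c) (hc1 : c < 1) :
    min f M * boundedLogDeriv a b g ≤ 1 + c * M ^ 2 / a ^ 2 +
      (1 - c) / c * (boundedLog a b (c * f + (1 - c) * g) - boundedLog a b g) := by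
  set m := min f M with hm
  have hm0 : 0 ≤ m := le_min hf hM
  have hmM : m ≤ M := min_le_right _ _
  have hc' : 0 < 1 - c := by linarith
  set x := c * m + (1 - c) * g with hx
  have hx0 : 0 ≤ x := by positivity
  have h1 : boundedLog a b x ≤ boundedLog a b (c * f + (1 - c) * g) := by
    refine boundedLog_mono ha hab hx0 ?_
    have : m ≤ f := min_le_left _ _
    rw [hx]
    gcongr
  have h2 := sub_mul_boundedLogDeriv_le ha hab hg hx0
  have h3 := mul_boundedLogDeriv_le_one ha hab hx0
  have h4 : boundedLogDeriv a b g - c * M / a ^ 2 ≤ boundedLogDeriv a b x := by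
    refine boundedLogDeriv_sub_le ha hab hg (by positivity) hx0 ?_
    have : c * m ≤ c * M := by gcongr
    nlinarith [mul_nonneg hc.le hg]
  have h5 : m * (boundedLogDeriv a b g - c * M / a ^ 2) ≤ m * boundedLogDeriv a b x := by gcongr
  have h6 : m * (c * M / a ^ 2) ≤ c * M ^ 2 / a ^ 2 := by
    have : m * (c * M / a ^ 2) ≤ M * (c * M / a ^ 2) := by gcongr
    calc _ ≤ _ := this
      _ = _ := by ring
  -- Both `m - x = (1 - c) * (m - g)` and `x - g = c * (m - g)`, whence the factor `(1 - c) / c`.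
  have h7 : m * boundedLogDeriv a b x - x * boundedLogDeriv a b x
      = (1 - c) / c * ((x - g) * boundedLogDeriv a b x) := by
    rw [hx]
    field_simp
    ring
  have h8 : (1 - c) / c * ((x - g) * boundedLogDeriv a b x) ≤
      (1 - c) / c * (boundedLog a b (c * f + (1 - c) * g) - boundedLog a b g) := by
    have : 0 ≤ (1 - c) / c := by positivity
    gcongr
    linarith
  linarith

end boundedLog

variable {Ω : Type*} [mΩ : MeasurableSpace Ω]

/-- In a convex set of nonnegative random variables, an almost maximiser of `E[boundedLog a b g]`
almost satisfies the first order condition, uniformly in the truncated directions. -/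
lemma exists_forall_integral_boundedLogDeriv_le (P : Measure Ω) [IsProbabilityMeasure P]
    {C : Set (Ω → ℝ)} (hC : C.Nonempty) (hmeas : ∀ f ∈ C, Measurable f)
    (hnonneg : ∀ f ∈ C, ∀ᵐ ω ∂P, 0 ≤ f ω)
    (hconv : ∀ f ∈ C, ∀ g ∈ C, ∀ c : ℝ, 0 ≤ c → c ≤ 1 →
      ∃ h ∈ C, ∀ᵐ ω ∂P, h ω = c * f ω + (1 - c) * g ω)
    {a b M δ : ℝ} (ha : 0 < a) (hab : a ≤ b) (hM : 0 ≤ M) (hδ : 0 < δ) :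
    ∃ g ∈ C, ∀ f ∈ C, ∫ ω, min (f ω) M * boundedLogDeriv a b (g ω) ∂P ≤ 1 + δ := by
  have hint : ∀ f ∈ C, Integrable (fun ω => boundedLog a b (f ω)) P := fun f hf =>
    Integrable.of_bound (measurable_boundedLog.comp (hmeas f hf)).aestronglyMeasurable
      |boundedLog a b 0| (by
        filter_upwards [hnonneg f hf] with ω hω using abs_boundedLog_le ha hab hω)
  set S : Set ℝ := (fun f : Ω → ℝ => ∫ ω, boundedLog a b (f ω) ∂P) '' C with hS
  have hbdd : BddAbove S := by
    refine ⟨0, ?_⟩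
    rintro _ ⟨f, hf, rfl⟩
    refine integral_nonpos_of_ae ?_
    filter_upwards [hnonneg f hf] with ω hω using boundedLog_nonpos ha hab hω
  set c : ℝ := min (1 / 2) (δ / 2 / (M ^ 2 / a ^ 2 + 1)) with hc
  have hc0 : 0 < c := lt_min (by norm_num) (by positivity)
  have hc1 : c < 1 := (min_le_left _ _).trans_lt (by norm_num)
  have hcM : c * M ^ 2 / a ^ 2 ≤ δ / 2 := by
    have h1 : c * (M ^ 2 / a ^ 2 + 1) ≤ δ / 2 := by
      rw [← le_div_iff₀ (by positivity)]
      exact min_le_right _ _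
    have h2 : c * M ^ 2 / a ^ 2 = c * (M ^ 2 / a ^ 2) := by ring
    nlinarith
  -- The optimality gap is later multiplied by `(1 - c) / c`, so it must be of order `c`. The step
  -- `c` depends only on `M`, `a` and `δ`, which gives uniformity in `f`.
  obtain ⟨_, ⟨g, hg, rfl⟩, hgS⟩ := exists_lt_of_lt_csSup (hC.image _)
    (show sSup S - c * (δ / 2) < sSup S by
      have : 0 < c * (δ / 2) := by positivity
      linarith)
  refine ⟨g, hg, fun f hf => ?_⟩
  obtain ⟨h, hh, hfg⟩ := hconv f hf g hg c hc0.le hc1.le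
  have hhS : ∫ ω, boundedLog a b (h ω) ∂P ≤ sSup S := le_csSup hbdd ⟨h, hh, rfl⟩
  have hpt : ∀ᵐ ω ∂P, min (f ω) M * boundedLogDeriv a b (g ω) ≤
      1 + c * M ^ 2 / a ^ 2 + (1 - c) / c * (boundedLog a b (h ω) - boundedLog a b (g ω)) := by
    filter_upwards [hnonneg f hf, hnonneg g hg, hfg] with ω h1 h2 h3
    rw [h3]
    exact min_mul_boundedLogDeriv_le ha hab h1 h2 hM hc0 hc1
  have hnn : ∀ᵐ ω ∂P, 0 ≤ min (f ω) M * boundedLogDeriv a b (g ω) := by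
    filter_upwards [hnonneg f hf, hnonneg g hg] with ω h1 h2
    exact mul_nonneg (le_min h1 hM) (boundedLogDeriv_nonneg ha hab h2)
  have hsub : Integrable (fun ω => boundedLog a b (h ω) - boundedLog a b (g ω)) P :=
    (hint h hh).sub (hint g hg)
  calc ∫ ω, min (f ω) M * boundedLogDeriv a b (g ω) ∂P
      ≤ ∫ ω, (1 + c * M ^ 2 / a ^ 2 +
        (1 - c) / c * (boundedLog a b (h ω) - boundedLog a b (g ω))) ∂P :=
        integral_mono_of_nonneg hnn ((integrable_const _).add (hsub.const_mul _)) hpt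
    _ = 1 + c * M ^ 2 / a ^ 2 + (1 - c) / c *
        (∫ ω, boundedLog a b (h ω) ∂P - ∫ ω, boundedLog a b (g ω) ∂P) := by
        rw [integral_add (integrable_const _) (hsub.const_mul _), integral_const_mul,
          integral_sub (hint h hh) (hint g hg)]
        simp
    _ ≤ 1 + δ / 2 + (1 - c) / c * (c * (δ / 2)) := by
        have : 0 ≤ (1 - c) / c := div_nonneg (by linarith) hc0.le
        gcongr
        simp only at hgS
        linarith
    _ ≤ 1 + δ := by
        have : (1 - c) / c * (c * (δ / 2)) = (1 - c) * (δ / 2) := by field_simp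
        nlinarith

end DiscreteMarket

/-! ### Almost sure compactness for sets bounded in probability. -/

namespace DiscreteMarket

variable {Ω : Type*} [mΩ : MeasurableSpace Ω]

/-- On a divergent path all late terms exceed `M`. The events "all terms from `N` on exceed `M`"
increase with `N`, and each has probability at most the supremum in the definition. -/
lemma BoundedInProbability.ae_not_tendsto_atTop {P : Measure Ω} {C : Set (Ω → ℝ)}
    (hC : BoundedInProbability P C) {g : ℕ → Ω → ℝ} (hg : ∀ n, g n ∈ C) :
    ∀ᵐ ω ∂P, ¬ Tendsto (fun n => g n ω) atTop atTop := by
  rw [ae_iff]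
  simp only [not_not]
  refine le_antisymm (ge_of_tendsto' hC fun M => ?_) zero_le
  have hsub : {ω | Tendsto (fun n => g n ω) atTop atTop} ⊆
      ⋃ N : ℕ, {ω | ∀ n ≥ N, M ≤ |g n ω|} := by
    intro ω hω
    obtain ⟨N, hN⟩ := eventually_atTop.1 (hω.eventually_ge_atTop M)
    exact Set.mem_iUnion.2 ⟨N, fun n hn => (hN n hn).trans (le_abs_self _)⟩
  have hmono : Monotone fun N : ℕ => {ω | ∀ n ≥ N, M ≤ |g n ω|} :=
    fun N N' h ω hω n hn => hω n (h.trans hn)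
  refine (measure_mono hsub).trans ?_
  rw [hmono.measure_iUnion]
  refine iSup_le fun N => ?_
  have hN : {ω | ∀ n ≥ N, M ≤ |g n ω|} ⊆ {ω | M ≤ |g N ω|} := fun ω (hω : ∀ n ≥ N, _) => hω N le_rfl
  refine (measure_mono hN).trans ?_
  exact le_iSup₂ (f := fun f (_ : f ∈ C) => P {ω | M ≤ |f ω|}) (g N) (hg N)

/-- A compactness principle of Komlós type: from a decreasing sequence of nonempty convex sets of
families of nonnegative random variables that are bounded in probability one can choose elements
that converge almost surely. -/
theorem exists_forall_mem_ae_tendsto {ι : Type*} [Fintype ι] (P : Measure Ω)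
    [IsProbabilityMeasure P] {K : ℕ → Set (ι → Ω → ℝ)} (hanti : Antitone K)
    (hne : ∀ n, (K n).Nonempty) (hmeas : ∀ Y ∈ K 0, ∀ i, Measurable (Y i))
    (hnonneg : ∀ Y ∈ K 0, ∀ i, ∀ᵐ ω ∂P, 0 ≤ Y i ω)
    (hmid : ∀ n, ∀ X ∈ K n, ∀ Y ∈ K n, ∃ W ∈ K n, ∀ i, ∀ᵐ ω ∂P, W i ω = (X i ω + Y i ω) / 2)
    (hbdd : ∀ i, BoundedInProbability P ((fun Y => Y i) '' K 0)) :
    ∃ g : ℕ → ι → Ω → ℝ, (∀ n, g n ∈ K n) ∧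
      ∀ᵐ ω ∂P, ∀ i, ∃ l : ℝ, Tendsto (fun n => g n i ω) atTop (𝓝 l) := by
  -- A bounded, strictly convex functional: near-minimisers over the sets `K n` must be close to
  -- each other.
  set V : (ι → Ω → ℝ) → ℝ := fun Y => ∑ i, ∫ ω, Real.exp (-Y i ω) ∂P with hV
  have hV0 : ∀ Y, 0 ≤ V Y := fun Y =>
    Finset.sum_nonneg fun i _ => integral_nonneg fun ω => (Real.exp_pos _).le
  have hK0 : ∀ {n Y}, Y ∈ K n → Y ∈ K 0 := fun h => hanti (zero_le) h
  have hexp : ∀ Y ∈ K 0, ∀ i, Integrable (fun ω => Real.exp (-Y i ω)) P := fun Y hY i =>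
    Integrable.of_bound (hmeas Y hY i).neg.exp.aestronglyMeasurable 1 (by
      filter_upwards [hnonneg Y hY i] with ω hω
      rw [Real.norm_eq_abs, Real.abs_exp, Real.exp_le_one_iff]
      linarith)
  have hV1 : ∀ Y ∈ K 0, V Y ≤ Fintype.card ι := by
    intro Y hY
    calc V Y ≤ ∑ i : ι, (1 : ℝ) := by
          refine Finset.sum_le_sum fun i _ => ?_
          calc ∫ ω, Real.exp (-Y i ω) ∂P ≤ ∫ _, (1 : ℝ) ∂P := by
                refine integral_mono_ae (hexp Y hY i) (integrable_const _) ?_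
                filter_upwards [hnonneg Y hY i] with ω hω
                rw [Real.exp_le_one_iff]
                linarith
            _ = 1 := by simp
      _ = _ := by simp
  set v : ℕ → ℝ := fun n => sInf (V '' K n) with hv
  have hbb : ∀ n, BddBelow (V '' K n) := fun n => ⟨0, by rintro _ ⟨Y, -, rfl⟩; exact hV0 Y⟩
  have hvle : ∀ n, ∀ Y ∈ K n, v n ≤ V Y := fun n Y hY => csInf_le (hbb n) ⟨Y, hY, rfl⟩
  have hvmono : Monotone v := fun m n h =>
    csInf_le_csInf (hbb m) ((hne n).image _) (Set.image_mono (hanti h))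
  have hvbdd : BddAbove (Set.range v) := by
    refine ⟨Fintype.card ι, ?_⟩
    rintro _ ⟨n, rfl⟩
    obtain ⟨Y, hY⟩ := hne n
    exact (hvle n Y hY).trans (hV1 Y (hK0 hY))
  set L := ⨆ n, v n with hL
  have hvL : ∀ n, v n ≤ L := fun n => le_ciSup hvbdd n
  -- Squared `L²` distances will be of order `r n`, so the distances themselves are summable.
  set r : ℕ → ℝ := fun n => (1 / 4) ^ n with hr
  have hr0 : ∀ n, 0 < r n := fun n => by positivity
  have hranti : Antitone r := pow_right_anti₀ (by norm_num) (by norm_num)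
  have hN : ∀ k, ∃ N ≥ k, L - r k ≤ v N := by
    intro k
    obtain ⟨N, hN⟩ := exists_lt_of_lt_ciSup (show L - r k < ⨆ n, v n by linarith [hr0 k])
    exact ⟨max N k, le_max_right _ _, hN.le.trans (hvmono (le_max_left _ _))⟩
  choose N hNk hNv using hN
  have hg : ∀ k, ∃ Y ∈ K (N k), V Y ≤ L + r k := by
    intro k
    obtain ⟨_, ⟨Y, hY, rfl⟩, h⟩ := exists_lt_of_csInf_lt ((hne (N k)).image V)
      (show sInf (V '' K (N k)) < L + r k by linarith [hr0 k, hvL (N k)])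
    exact ⟨Y, hY, h.le⟩
  choose g hgK hgV using hg
  have hg0 : ∀ k, g k ∈ K 0 := fun k => hK0 (hgK k)
  refine ⟨g, fun n => hanti (hNk n) (hgK n), ?_⟩
  rw [ae_all_iff]
  intro i
  set h : ℕ → Ω → ℝ := fun k ω => Real.exp (-g k i ω / 2) with hh
  have hhm : ∀ k, Measurable (h k) := fun k => ((hmeas _ (hg0 k) i).neg.div_const 2).exp
  have hhsq : ∀ X ∈ K 0, ∀ Y ∈ K 0, ∀ j, Integrable
      (fun ω => (Real.exp (-X j ω / 2) - Real.exp (-Y j ω / 2)) ^ 2) P := fun X hX Y hY j =>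
    Integrable.of_bound ((((hmeas X hX j).neg.div_const 2).exp.sub
        ((hmeas Y hY j).neg.div_const 2).exp).pow_const 2).aestronglyMeasurable 1 (by
      filter_upwards [hnonneg X hX j, hnonneg Y hY j] with ω h1 h2
      have e1 : Real.exp (-X j ω / 2) ≤ 1 := by rw [Real.exp_le_one_iff]; linarith
      have e2 : Real.exp (-Y j ω / 2) ≤ 1 := by rw [Real.exp_le_one_iff]; linarith
      have e3 := Real.exp_pos (-X j ω / 2)
      have e4 := Real.exp_pos (-Y j ω / 2)
      rw [Real.norm_eq_abs, abs_of_nonneg (sq_nonneg _), sq_le_one_iff_abs_le_one, abs_le]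
      constructor <;> linarith)
  have hgap : ∀ n k l, n ≤ k → n ≤ l → ∫ ω, (h k ω - h l ω) ^ 2 ∂P ≤ 4 * r n := by
    intro n k l hnk hnl
    set p := min (N k) (N l) with hp
    obtain ⟨W, hW, hWe⟩ := hmid p _ (hanti (min_le_left _ _) (hgK k))
      _ (hanti (min_le_right _ _) (hgK l))
    have hvp : L - r n ≤ v p := by
      have h1 : L - r n ≤ v (N k) := by linarith [hNv k, hranti hnk]
      have h2 : L - r n ≤ v (N l) := by linarith [hNv l, hranti hnl]
      rcases min_choice (N k) (N l) with h | h <;> rw [hp, h] <;> assumption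
    have hVW := hvle p W hW
    -- The exponential at the midpoint is the product of the two half-exponentials, so the convexity
    -- gap of `V` is exactly a sum of squared `L²` distances.
    have hsq : ∀ j, ∫ ω, (Real.exp (-g k j ω / 2) - Real.exp (-g l j ω / 2)) ^ 2 ∂P =
        ∫ ω, Real.exp (-g k j ω) ∂P + ∫ ω, Real.exp (-g l j ω) ∂P
          - 2 * ∫ ω, Real.exp (-W j ω) ∂P := by
      intro j
      have hadd : Integrable (fun ω => Real.exp (-g k j ω) + Real.exp (-g l j ω)) P :=
        (hexp _ (hg0 k) j).add (hexp _ (hg0 l) j)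
      rw [← integral_const_mul, ← integral_add (hexp _ (hg0 k) j) (hexp _ (hg0 l) j),
        ← integral_sub hadd ((hexp W (hK0 hW) j).const_mul 2)]
      refine integral_congr_ae ?_
      filter_upwards [hWe j] with ω hω
      have e1 : Real.exp (-g k j ω) = Real.exp (-g k j ω / 2) ^ 2 := by
        rw [← Real.exp_nat_mul]; congr 1; push_cast; ring
      have e2 : Real.exp (-g l j ω) = Real.exp (-g l j ω / 2) ^ 2 := by
        rw [← Real.exp_nat_mul]; congr 1; push_cast; ring
      have e3 : Real.exp (-W j ω) = Real.exp (-g k j ω / 2) * Real.exp (-g l j ω / 2) := by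
        rw [← Real.exp_add, hω]; congr 1; ring
      rw [e1, e2, e3]
      ring
    calc ∫ ω, (h k ω - h l ω) ^ 2 ∂P
        ≤ ∑ j, ∫ ω, (Real.exp (-g k j ω / 2) - Real.exp (-g l j ω / 2)) ^ 2 ∂P :=
          Finset.single_le_sum (f := fun j =>
            ∫ ω, (Real.exp (-g k j ω / 2) - Real.exp (-g l j ω / 2)) ^ 2 ∂P)
            (fun j _ => integral_nonneg fun ω => sq_nonneg _) (Finset.mem_univ i)
      _ = V (g k) + V (g l) - 2 * V W := by
          simp only [hsq, hV, Finset.sum_sub_distrib, Finset.sum_add_distrib, Finset.mul_sum]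
      _ ≤ 4 * r n := by linarith [hgV k, hgV l, hranti hnk, hranti hnl]
  have hconv : ∀ᵐ ω ∂P, ∃ l : ℝ, Tendsto (fun n => h n ω) atTop (𝓝 l) := by
    refine Lp.ae_tendsto_of_cauchy_eLpNorm (p := 2) (fun n => (hhm n).aestronglyMeasurable)
      (by norm_num) (B := fun n => ENNReal.ofReal (4 * (1 / 2) ^ n))
      (Summable.tsum_ofReal_ne_top ((summable_geometric_of_lt_one (by norm_num)
        (by norm_num)).mul_left _)) ?_
    intro n k l hnk hnl
    have hmem : MemLp (h k - h l) 2 P :=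
      (memLp_two_iff_integrable_sq ((hhm k).sub (hhm l)).aestronglyMeasurable).2
        (hhsq _ (hg0 k) _ (hg0 l) i)
    rw [hmem.eLpNorm_eq_integral_rpow_norm (by norm_num) (by norm_num)]
    rw [ENNReal.ofReal_lt_ofReal_iff (by positivity)]
    have e : ∫ ω, ‖(h k - h l) ω‖ ^ (2 : ℝ≥0∞).toReal ∂P = ∫ ω, (h k ω - h l ω) ^ 2 ∂P := by
      refine integral_congr_ae (ae_of_all _ fun ω => ?_)
      simp
    rw [e]
    have e2 : ((2 : ℝ≥0∞).toReal)⁻¹ = 1 / 2 := by simp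
    rw [e2, ← Real.sqrt_eq_rpow, Real.sqrt_lt' (by positivity)]
    refine (hgap n k l hnk hnl).trans_lt ?_
    have : (4 * (1 / 2 : ℝ) ^ n) ^ 2 = 16 * (1 / 4) ^ n := by
      rw [mul_pow, ← pow_mul, mul_comm n 2, pow_mul]; norm_num
    rw [this]
    have := hr0 n
    simp only [hr] at this ⊢
    linarith
  filter_upwards [hconv, (hbdd i).ae_not_tendsto_atTop (g := fun n => g n i)
    fun n => ⟨g n, hg0 n, rfl⟩] with ω ⟨l, hl⟩ hω
  have hl0 : 0 ≤ l := ge_of_tendsto' hl fun n => (Real.exp_pos _).le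
  -- A zero limit of `exp (-g / 2)` would mean that `g` tends to infinity, which boundedness in
  -- probability excludes.
  have hlne : l ≠ 0 := by
    rintro rfl
    refine hω ?_
    have h1 : Tendsto (fun n => -g n i ω / 2) atTop atBot :=
      Real.tendsto_exp_comp_nhds_zero.1 hl
    have h2 : Tendsto (fun n => -2 * (-g n i ω / 2)) atTop atTop :=
      h1.const_mul_atBot_of_neg (by norm_num)
    refine h2.congr fun n => by ring
  refine ⟨-2 * Real.log l, ?_⟩
  refine ((hl.log hlne).const_mul (-2)).congr fun n => ?_
  simp only [hh, Real.log_exp]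
  ring

end DiscreteMarket

/-! ### Essential supports and the lifetime of a market. -/

namespace DiscreteMarket

variable {Ω : Type*} [mΩ : MeasurableSpace Ω] {T : ℕ}

/-- A set of nonnegative random variables which contains midpoints has a countable subset that
detects its essential support. -/
lemma exists_seq_forall_ae_nonpos (P : Measure Ω) [IsFiniteMeasure P] {C : Set (Ω → ℝ)}
    (hC : C.Nonempty) (hmeas : ∀ f ∈ C, Measurable f) (hnonneg : ∀ f ∈ C, ∀ᵐ ω ∂P, 0 ≤ f ω)
    (hmid : ∀ f ∈ C, ∀ g ∈ C, ∃ h ∈ C, ∀ᵐ ω ∂P, h ω = (f ω + g ω) / 2) :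
    ∃ f : ℕ → Ω → ℝ, (∀ n, f n ∈ C) ∧ ∀ h ∈ C, ∀ᵐ ω ∂P, (∀ n, f n ω ≤ 0) → h ω ≤ 0 := by
  obtain ⟨u, -, hu, huS⟩ := exists_seq_tendsto_sSup
    (hC.image fun f : Ω → ℝ => P {ω | 0 < f ω}) (OrderTop.bddAbove _)
  choose f hf hfu using huS
  refine ⟨f, hf, fun h hh => ?_⟩
  set s := sSup ((fun f : Ω → ℝ => P {ω | 0 < f ω}) '' C) with hs
  have hsP : s ≤ P Set.univ := sSup_le (by
    rintro _ ⟨f, -, rfl⟩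
    exact measure_mono (Set.subset_univ _))
  have hpos : ∀ g ∈ C, MeasurableSet {ω | 0 < g ω} := fun g hg =>
    measurableSet_lt measurable_const (hmeas g hg)
  have hbound : ∀ n, P ({ω | 0 < h ω} \ {ω | 0 < f n ω}) ≤ s - u n := by
    intro n
    -- The midpoint is positive wherever either function is, so the union of the two supports has
    -- measure at most the supremum `s`.
    obtain ⟨k, hk, hke⟩ := hmid h hh (f n) (hf n)
    have h1 : P ({ω | 0 < f n ω} ∪ {ω | 0 < h ω}) ≤ s := by
      refine le_trans (measure_mono_ae ?_) (le_sSup ⟨k, hk, rfl⟩)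
      filter_upwards [hke, hnonneg h hh, hnonneg (f n) (hf n)] with ω e e1 e2 hω
      change 0 < k ω
      rw [e]
      rcases hω with hω | hω
      · have : 0 < f n ω := hω
        linarith
      · have : 0 < h ω := hω
        linarith
    rw [← Set.union_sdiff_left, measure_sdiff Set.subset_union_left
      (hpos _ (hf n)).nullMeasurableSet (measure_ne_top _ _), ← hfu n]
    exact tsub_le_tsub_right h1 _
  have hlim : Tendsto (fun n => s - u n) atTop (𝓝 0) := by
    have := ENNReal.Tendsto.sub (tendsto_const_nhds (x := s)) hu
      (Or.inl (ne_top_of_le_ne_top (measure_ne_top P _) hsP))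
    rwa [tsub_self] at this
  rw [ae_iff]
  refine le_antisymm (ge_of_tendsto' hlim fun n => le_trans (measure_mono ?_) (hbound n)) zero_le
  intro ω hω
  simp only [Set.mem_ofPred_eq, not_forall, not_le] at hω
  obtain ⟨h1, h2⟩ := hω
  exact ⟨h2, not_lt.2 (h1 n)⟩

lemma measurable_eval_comp {X : Fin (T + 1) → Ω → ℝ} (hX : ∀ t, Measurable (X t))
    {τ : Ω → Fin (T + 1)} (hτ : Measurable τ) : Measurable fun ω => X (τ ω) ω :=
  (measurable_from_prod_countable_right (f := fun p : Fin (T + 1) × Ω => X p.1 p.2) hX).comp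
    (hτ.prodMk measurable_id)

variable {P : Measure Ω} {𝒳 : Set (Fin (T + 1) → Ω → ℝ)}

lemma GeneralizedForkConvex.exists_convexCombination {ℱ : Filtration (Fin (T + 1)) mΩ}
    (h : GeneralizedForkConvex P ℱ 𝒳) {X Y : Fin (T + 1) → Ω → ℝ} (hX : X ∈ 𝒳) (hY : Y ∈ 𝒳) {c : ℝ}
    (h0 : 0 ≤ c) (h1 : c ≤ 1) :
    ∃ W ∈ 𝒳, ∀ᵐ ω ∂P, ∀ t, W t ω = c * X t ω + (1 - c) * Y t ω := by
  obtain ⟨W, hW, he⟩ := h.convex X hX Y hY c h0 h1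
  refine ⟨W, hW, ae_all_iff.2 fun t => ?_⟩
  filter_upwards [he t] with ω hω
  rw [hω]
  rfl

lemma GeneralizedForkConvex.exists_midpoint {ℱ : Filtration (Fin (T + 1)) mΩ}
    (h : GeneralizedForkConvex P ℱ 𝒳) {X Y : Fin (T + 1) → Ω → ℝ} (hX : X ∈ 𝒳) (hY : Y ∈ 𝒳) :
    ∃ W ∈ 𝒳, ∀ᵐ ω ∂P, ∀ t, W t ω = (X t ω + Y t ω) / 2 := by
  obtain ⟨W, hW, he⟩ := h.exists_convexCombination hX hY (c := 1 / 2) (by norm_num) (by norm_num)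
  refine ⟨W, hW, he.mono fun ω hω t => ?_⟩
  rw [hω]
  ring

lemma IsMarket.ae_nonneg (h : IsMarket P 𝒳) {X : Fin (T + 1) → Ω → ℝ} (hX : X ∈ 𝒳) :
    ∀ᵐ ω ∂P, ∀ t, 0 ≤ X t ω :=
  ae_all_iff.2 (h.process X hX).nonneg

open Classical in
/-- The lifetime of a market: a random time after which all wealth processes vanish, and at which
one of countably many wealth processes is positive. -/
theorem IsMarket.exists_lifetime [IsFiniteMeasure P] (h : IsMarket P 𝒳) (hne : 𝒳.Nonempty)
    (hmid : ∀ X ∈ 𝒳, ∀ Y ∈ 𝒳, ∃ W ∈ 𝒳, ∀ᵐ ω ∂P, ∀ t, W t ω = (X t ω + Y t ω) / 2) :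
    ∃ (τ : Ω → Fin (T + 1)) (Y : Fin (T + 1) → ℕ → Fin (T + 1) → Ω → ℝ), Measurable τ ∧
      (∀ t n, Y t n ∈ 𝒳) ∧ (∀ X ∈ 𝒳, ∀ᵐ ω ∂P, ∀ t, τ ω < t → X t ω = 0) ∧
      ∀ᵐ ω ∂P, ∃ t n, 0 < Y t n (τ ω) ω := by
  have key : ∀ t : Fin (T + 1), ∃ Y : ℕ → Fin (T + 1) → Ω → ℝ, (∀ n, Y n ∈ 𝒳) ∧
      ∀ X ∈ 𝒳, ∀ᵐ ω ∂P, (∀ n, Y n t ω ≤ 0) → X t ω ≤ 0 := by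
    intro t
    obtain ⟨f, hf, hf'⟩ := exists_seq_forall_ae_nonpos P (hne.image fun X => X t)
      (by rintro _ ⟨X, hX, rfl⟩; exact (h.process X hX).measurable t)
      (by rintro _ ⟨X, hX, rfl⟩; exact (h.process X hX).nonneg t)
      (by
        rintro _ ⟨X, hX, rfl⟩ _ ⟨Y, hY, rfl⟩
        obtain ⟨W, hW, he⟩ := hmid X hX Y hY
        exact ⟨_, ⟨W, hW, rfl⟩, he.mono fun ω hω => hω t⟩)
    choose Y hY hYf using hf
    refine ⟨Y, hY, fun X hX => ?_⟩
    filter_upwards [hf' _ ⟨X, hX, rfl⟩] with ω hω hn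
    exact hω fun n => by rw [← hYf n]; exact hn n
  choose Y hY hYX using key
  -- The last date at which some wealth process is alive. The supremum is a.s. attained, since date
  -- `0` always qualifies by `X 0 = 1`.
  let φ : (Fin (T + 1) → Prop) → Fin (T + 1) := fun p => (Finset.univ.filter p).sup id
  let G : Fin (T + 1) → Set Ω := fun t => ⋃ n, {ω | 0 < Y t n t ω}
  have hG : ∀ t, MeasurableSet (G t) := fun t => MeasurableSet.iUnion fun n =>
    measurableSet_lt measurable_const ((h.process _ (hY t n)).measurable t)
  have hm : Measurable fun (ω : Ω) (t : Fin (T + 1)) => ω ∈ G t :=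
    measurable_pi_iff.2 fun t => measurableSet_setOfPred.1 (hG t)
  refine ⟨fun ω => φ fun t => ω ∈ G t, Y, (Measurable.of_discrete (f := φ)).comp hm, hY, ?_, ?_⟩
  · intro X hX
    rw [ae_all_iff]
    intro t
    filter_upwards [hYX t X hX, (h.process X hX).nonneg t] with ω hω h0 ht
    refine le_antisymm (hω fun n => ?_) h0
    by_contra! hcon
    refine absurd ht (not_lt.2 (Finset.le_sup (f := id) (b := t) ?_))
    simp only [Finset.mem_filter, Finset.mem_univ, true_and]
    exact Set.mem_iUnion.2 ⟨n, hcon⟩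
  · filter_upwards [h.initial _ (hY 0 0)] with ω hω
    have h0 : (0 : Fin (T + 1)) ∈ Finset.univ.filter fun t => ω ∈ G t := by
      simp only [Finset.mem_filter, Finset.mem_univ, true_and]
      exact Set.mem_iUnion.2 ⟨0, by simp [hω]⟩
    obtain ⟨t, ht, hte⟩ := Finset.exists_mem_eq_sup _ ⟨_, h0⟩ (id : Fin (T + 1) → Fin (T + 1))
    simp only [Finset.mem_filter, Finset.mem_univ, true_and] at ht
    obtain ⟨n, hn⟩ := Set.mem_iUnion.1 ht
    refine ⟨t, n, ?_⟩
    have : (φ fun t => ω ∈ G t) = t := hte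
    rw [this]
    exact hn

end DiscreteMarket

/-! ### The numéraire at a random time. -/

namespace DiscreteMarket

/-- Along convergent sequences, `boundedLogDeriv (1 / (n + 1)) (n + 1)` tends to `x ↦ 1 / x`. -/
lemma le_liminf_min_mul_boundedLogDeriv {y l : ℝ} {x : ℕ → ℝ} (hy : 0 ≤ y) (hx : ∀ n, 0 ≤ x n)
    (hl : Tendsto x atTop (𝓝 l)) :
    ENNReal.ofReal y / ENNReal.ofReal l ≤ liminf (fun n : ℕ => ENNReal.ofReal
      (min y n * boundedLogDeriv (1 / ((n : ℝ) + 1)) ((n : ℝ) + 1) (x n))) atTop := by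
  have hl0 : 0 ≤ l := ge_of_tendsto' hl hx
  have hmin : Tendsto (fun n : ℕ => min y (n : ℝ)) atTop (𝓝 y) := by
    refine tendsto_const_nhds.congr' ?_
    filter_upwards [tendsto_natCast_atTop_atTop.eventually_ge_atTop y] with n hn
    exact (min_eq_left hn).symm
  have hden : Tendsto (fun n : ℕ => x n + 1 / ((n : ℝ) + 1)) atTop (𝓝 l) := by
    simpa using hl.add tendsto_one_div_add_atTop_nhds_zero_nat
  have hneg : Tendsto (fun n : ℕ => -(x n + ((n : ℝ) + 1))⁻¹) atTop (𝓝 0) := by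
    have h1 : Tendsto (fun n : ℕ => x n + ((n : ℝ) + 1)) atTop atTop :=
      hl.add_atTop (tendsto_atTop_add_const_right _ _ tendsto_natCast_atTop_atTop)
    simpa using h1.inv_tendsto_atTop.neg
  rcases hl0.eq_or_lt with rfl | hlpos
  · rcases hy.eq_or_lt with rfl | hypos
    · simp
    · have hden' : Tendsto (fun n : ℕ => x n + 1 / ((n : ℝ) + 1)) atTop (𝓝[>] 0) :=
        tendsto_nhdsWithin_iff.2 ⟨hden, Eventually.of_forall fun n =>
          add_pos_of_nonneg_of_pos (hx n) (by positivity)⟩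
      have h1 : Tendsto (fun n : ℕ => boundedLogDeriv (1 / ((n : ℝ) + 1)) ((n : ℝ) + 1) (x n))
          atTop atTop := by
        exact hden'.inv_tendsto_nhdsGT_zero.atTop_add hneg
      have h2 := ENNReal.tendsto_ofReal_atTop.comp (hmin.pos_mul_atTop hypos h1)
      rw [show liminf (fun n : ℕ => ENNReal.ofReal
        (min y n * boundedLogDeriv (1 / ((n : ℝ) + 1)) ((n : ℝ) + 1) (x n))) atTop = ⊤
        from h2.liminf_eq]
      exact le_top
  · have h1 : Tendsto (fun n : ℕ => boundedLogDeriv (1 / ((n : ℝ) + 1)) ((n : ℝ) + 1) (x n))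
        atTop (𝓝 l⁻¹) := by
      simpa only [boundedLogDeriv, sub_eq_add_neg, add_zero] using
        (hden.inv₀ hlpos.ne').add hneg
    have h2 := ENNReal.tendsto_ofReal (hmin.mul h1)
    rw [h2.liminf_eq, ← div_eq_mul_inv, ENNReal.ofReal_div_of_pos hlpos]

variable {Ω : Type*} [mΩ : MeasurableSpace Ω] {T : ℕ} {P : Measure Ω}
  {𝒳 : Set (Fin (T + 1) → Ω → ℝ)}

/-- Existence of a numéraire at a random time `τ`: a sequence in the market converges almost surely,
and the value at `τ` of the limit is the numéraire of all values at `τ`. -/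
theorem IsMarket.exists_numeraire [IsProbabilityMeasure P] {ℱ : Filtration (Fin (T + 1)) mΩ}
    (h : IsMarket P 𝒳) (hconv : GeneralizedForkConvex P ℱ 𝒳) (hne : 𝒳.Nonempty)
    (hbdd : ∀ t, NUPBR P 𝒳 t) {τ : Ω → Fin (T + 1)} (hτ : Measurable τ) :
    ∃ g : ℕ → Fin (T + 1) → Ω → ℝ, (∀ n, g n ∈ 𝒳) ∧
      (∀ᵐ ω ∂P, ∀ t, ∃ l : ℝ, Tendsto (fun n => g n t ω) atTop (𝓝 l)) ∧
      ∀ Y ∈ 𝒳, ∫⁻ ω, ENNReal.ofReal (Y (τ ω) ω) /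
        ENNReal.ofReal (limsup (fun n => g n (τ ω) ω) atTop) ∂P ≤ 1 := by
  set w : ℕ → ℝ → ℝ := fun n => boundedLogDeriv (1 / ((n : ℝ) + 1)) ((n : ℝ) + 1) with hw
  have ha : ∀ n : ℕ, (0 : ℝ) < 1 / ((n : ℝ) + 1) := fun n => by positivity
  have hab : ∀ n : ℕ, 1 / ((n : ℝ) + 1) ≤ (n : ℝ) + 1 := fun n => by
    have h0 : (0 : ℝ) ≤ n := n.cast_nonneg
    rw [div_le_iff₀ (by positivity)]
    nlinarith
  have hwm : ∀ n, Measurable (w n) := fun n => measurable_boundedLogDeriv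
  have hXm : ∀ X ∈ 𝒳, Measurable fun ω => X (τ ω) ω := fun X hX =>
    measurable_eval_comp (h.process X hX).measurable hτ
  have hprodm : ∀ (n : ℕ), ∀ X ∈ 𝒳, ∀ Y ∈ 𝒳,
      Measurable fun ω => min (Y (τ ω) ω) n * w n (X (τ ω) ω) := fun n X hX Y hY =>
    ((hXm Y hY).min measurable_const).mul ((hwm n).comp (hXm X hX))
  have hprod0 : ∀ (n : ℕ), ∀ X ∈ 𝒳, ∀ Y ∈ 𝒳,
      ∀ᵐ ω ∂P, 0 ≤ min (Y (τ ω) ω) n * w n (X (τ ω) ω) := fun n X hX Y hY => by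
    filter_upwards [h.ae_nonneg hX, h.ae_nonneg hY] with ω h1 h2
    exact mul_nonneg (le_min (h2 _) n.cast_nonneg) (boundedLogDeriv_nonneg (ha n) (hab n) (h1 _))
  have hint : ∀ (n : ℕ), ∀ X ∈ 𝒳, ∀ Y ∈ 𝒳,
      Integrable (fun ω => min (Y (τ ω) ω) n * w n (X (τ ω) ω)) P := fun n X hX Y hY =>
    Integrable.of_bound (hprodm n X hX Y hY).aestronglyMeasurable
      (n * (1 / ((n : ℝ) + 1))⁻¹) (by
        filter_upwards [h.ae_nonneg hX, h.ae_nonneg hY, hprod0 n X hX Y hY] with ω h1 h2 h3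
        rw [Real.norm_eq_abs, abs_of_nonneg h3]
        exact mul_le_mul (min_le_right _ _) (boundedLogDeriv_le_inv (ha n) (hab n) (h1 _))
          (boundedLogDeriv_nonneg (ha n) (hab n) (h1 _)) n.cast_nonneg)
  -- Near-maximisers for different `n` solve unrelated problems; their first order conditions, in
  -- contrast, define sets that decrease in `n` and contain midpoints.
  set K : ℕ → Set (Fin (T + 1) → Ω → ℝ) := fun n => {X | X ∈ 𝒳 ∧ ∀ Y ∈ 𝒳,
    ∫ ω, min (Y (τ ω) ω) n * w n (X (τ ω) ω) ∂P ≤ 1 + 1 / ((n : ℝ) + 1)} with hK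
  have hanti : Antitone K := by
    intro m n hmn X hX
    have hmn' : (m : ℝ) ≤ n := by exact_mod_cast hmn
    refine ⟨hX.1, fun Y hY => ?_⟩
    calc ∫ ω, min (Y (τ ω) ω) m * w m (X (τ ω) ω) ∂P
        ≤ ∫ ω, min (Y (τ ω) ω) n * w n (X (τ ω) ω) ∂P := by
          refine integral_mono_ae (hint m X hX.1 Y hY) (hint n X hX.1 Y hY) ?_
          filter_upwards [h.ae_nonneg hX.1, h.ae_nonneg hY] with ω h1 h2
          exact mul_le_mul (min_le_min_left _ hmn')
            (boundedLogDeriv_mono (ha n) (one_div_le_one_div_of_le (by positivity) (by linarith))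
              (by positivity) (by linarith) (h1 _))
            (boundedLogDeriv_nonneg (ha m) (hab m) (h1 _)) (le_min (h2 _) n.cast_nonneg)
      _ ≤ 1 + 1 / ((n : ℝ) + 1) := hX.2 Y hY
      _ ≤ 1 + 1 / ((m : ℝ) + 1) := by gcongr
  have hKne : ∀ n, (K n).Nonempty := by
    intro n
    obtain ⟨_, ⟨X, hX, rfl⟩, hg⟩ := exists_forall_integral_boundedLogDeriv_le P
      (C := (fun (X : Fin (T + 1) → Ω → ℝ) ω => X (τ ω) ω) '' 𝒳) (hne.image _)
      (by rintro _ ⟨X, hX, rfl⟩; exact hXm X hX)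
      (by rintro _ ⟨X, hX, rfl⟩; exact (h.ae_nonneg hX).mono fun ω hω => hω _)
      (by
        rintro _ ⟨X, hX, rfl⟩ _ ⟨Y, hY, rfl⟩ c h0 h1
        obtain ⟨W, hW, he⟩ := hconv.exists_convexCombination hX hY h0 h1
        exact ⟨_, ⟨W, hW, rfl⟩, he.mono fun ω hω => hω _⟩)
      (ha n) (hab n) (M := n) n.cast_nonneg (ha n)
    exact ⟨X, hX, fun Y hY => hg _ ⟨Y, hY, rfl⟩⟩
  have hKmid : ∀ n, ∀ X ∈ K n, ∀ Y ∈ K n, ∃ W ∈ K n,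
      ∀ t, ∀ᵐ ω ∂P, W t ω = (X t ω + Y t ω) / 2 := by
    intro n X hX Y hY
    obtain ⟨W, hW, he⟩ := hconv.exists_midpoint hX.1 hY.1
    refine ⟨W, ⟨hW, fun V hV => ?_⟩, ae_all_iff.1 he⟩
    calc ∫ ω, min (V (τ ω) ω) n * w n (W (τ ω) ω) ∂P
        ≤ ∫ ω, (1 / 2 * (min (V (τ ω) ω) n * w n (X (τ ω) ω)) +
            1 / 2 * (min (V (τ ω) ω) n * w n (Y (τ ω) ω))) ∂P := by
          refine integral_mono_ae (hint n W hW V hV)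
            (((hint n X hX.1 V hV).const_mul _).add ((hint n Y hY.1 V hV).const_mul _)) ?_
          filter_upwards [h.ae_nonneg hX.1, h.ae_nonneg hY.1, h.ae_nonneg hV, he] with ω h1 h2 h3 h4
          rw [h4]
          have := mul_le_mul_of_nonneg_left
            (boundedLogDeriv_midpoint (ha n) (hab n) (h1 (τ ω)) (h2 (τ ω)))
            (le_min (h3 (τ ω)) n.cast_nonneg : (0 : ℝ) ≤ min (V (τ ω) ω) n)
          simp only [hw]
          linarith
      _ = 1 / 2 * ∫ ω, min (V (τ ω) ω) n * w n (X (τ ω) ω) ∂P +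
            1 / 2 * ∫ ω, min (V (τ ω) ω) n * w n (Y (τ ω) ω) ∂P := by
          rw [integral_add ((hint n X hX.1 V hV).const_mul _) ((hint n Y hY.1 V hV).const_mul _),
            integral_const_mul, integral_const_mul]
      _ ≤ 1 + 1 / ((n : ℝ) + 1) := by linarith [hX.2 V hV, hY.2 V hV]
  have hbddK : ∀ t, BoundedInProbability P ((fun Y => Y t) '' K 0) := fun t =>
    tendsto_of_tendsto_of_tendsto_of_le_of_le tendsto_const_nhds (hbdd t) (fun _ => zero_le)
      fun M => biSup_mono (Set.image_mono fun X hX => hX.1)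
  obtain ⟨g, hgK, hg⟩ := exists_forall_mem_ae_tendsto P hanti hKne
    (fun Y hY => (h.process Y hY.1).measurable) (fun Y hY => (h.process Y hY.1).nonneg) hKmid hbddK
  refine ⟨g, fun n => (hgK n).1, hg, fun Y hY => ?_⟩
  calc ∫⁻ ω, ENNReal.ofReal (Y (τ ω) ω) /
        ENNReal.ofReal (limsup (fun n => g n (τ ω) ω) atTop) ∂P
      ≤ ∫⁻ ω, liminf (fun n : ℕ => ENNReal.ofReal
          (min (Y (τ ω) ω) n * w n (g n (τ ω) ω))) atTop ∂P := by
        refine lintegral_mono_ae ?_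
        filter_upwards [hg, h.ae_nonneg hY, ae_all_iff.2 fun n => h.ae_nonneg (hgK n).1]
          with ω h1 h2 h3
        obtain ⟨l, hl⟩ := h1 (τ ω)
        rw [hl.limsup_eq]
        exact le_liminf_min_mul_boundedLogDeriv (h2 _) (fun n => h3 n _) hl
    _ ≤ liminf (fun n : ℕ => ∫⁻ ω, ENNReal.ofReal
          (min (Y (τ ω) ω) n * w n (g n (τ ω) ω)) ∂P) atTop :=
        lintegral_liminf_le fun n => (hprodm n _ (hgK n).1 Y hY).ennreal_ofReal
    _ ≤ liminf (fun n : ℕ => ENNReal.ofReal (1 + 1 / ((n : ℝ) + 1))) atTop := by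
        refine liminf_le_liminf (Eventually.of_forall fun n => ?_)
        rw [← ofReal_integral_eq_lintegral_ofReal (hint n _ (hgK n).1 Y hY)
          (hprod0 n _ (hgK n).1 Y hY)]
        exact ENNReal.ofReal_le_ofReal ((hgK n).2 Y hY)
    _ = 1 := by
        have h1 : Tendsto (fun n : ℕ => 1 + 1 / ((n : ℝ) + 1)) atTop (𝓝 (1 + 0)) :=
          tendsto_const_nhds.add tendsto_one_div_add_atTop_nhds_zero_nat
        rw [(ENNReal.tendsto_ofReal h1).liminf_eq]
        simp

end DiscreteMarket

/-! ### From the numéraire at the lifetime to a deflator, by switching. -/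

namespace DiscreteMarket

variable {Ω : Type*} {T : ℕ}

/-- The pointwise upper limit of a sequence of processes. -/
noncomputable def limitProcess (g : ℕ → Fin (T + 1) → Ω → ℝ) : Fin (T + 1) → Ω → ℝ :=
  fun t ω => limsup (fun n => g n t ω) atTop

open Classical in
/-- The reciprocal of the limit of a sequence of processes, with value `1` where the limit is not
positive. -/
noncomputable def reciprocalLimit (g : ℕ → Fin (T + 1) → Ω → ℝ) : Fin (T + 1) → Ω → ℝ :=
  fun t ω => if 0 < limitProcess g t ω then (limitProcess g t ω)⁻¹ else 1

lemma reciprocalLimit_pos (g : ℕ → Fin (T + 1) → Ω → ℝ) (t : Fin (T + 1)) (ω : Ω) :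
    0 < reciprocalLimit g t ω := by
  unfold reciprocalLimit
  split_ifs with h
  · exact inv_pos.2 h
  · exact one_pos

lemma measurable_limitProcess {m : MeasurableSpace Ω} {g : ℕ → Fin (T + 1) → Ω → ℝ}
    {t : Fin (T + 1)} (hg : ∀ n, Measurable[m] (g n t)) : Measurable[m] (limitProcess g t) :=
  Measurable.limsup hg

lemma measurable_reciprocalLimit {m : MeasurableSpace Ω} {g : ℕ → Fin (T + 1) → Ω → ℝ}
    {t : Fin (T + 1)} (hg : ∀ n, Measurable[m] (g n t)) : Measurable[m] (reciprocalLimit g t) :=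
  Measurable.ite (measurableSet_lt measurable_const (measurable_limitProcess hg))
    (measurable_limitProcess hg).inv measurable_const

section switchIntegrand

variable (τ : Ω → Fin (T + 1)) (N : Ω → ℝ) (G X : Fin (T + 1) → Ω → ℝ) (s t : Fin (T + 1))
  (A : Set Ω)

open Classical in
/-- A lower bound of the value at time `τ`, in units of `N`, of the process which follows `G`,
switches to `X` at time `s` on `A`, and back to `G` at time `t`. -/
noncomputable def switchIntegrand (ω : Ω) : ℝ≥0∞ :=
  if ω ∈ A then
    if t ≤ τ ω then
      ENNReal.ofReal (G s ω) / ENNReal.ofReal (X s ω) *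
        (ENNReal.ofReal (G (τ ω) ω) / ENNReal.ofReal (G t ω)) *
        ENNReal.ofReal (X t ω) / ENNReal.ofReal (N ω)
    else 0
  else ENNReal.ofReal (G (τ ω) ω) / ENNReal.ofReal (N ω)

variable {τ N G X s t A}

/-- The disjunction `hpos` excludes the indeterminate product `0 * ∞`. The case `Z t = 0` with `Z s
> 0` is allowed and gives the limit `∞`, which is used to prove that the numéraire is positive up to
`τ`. -/
lemma tendsto_switchIntegrand {g : ℕ → Fin (T + 1) → Ω → ℝ} {ω : Ω} {Z : Fin (T + 1) → ℝ}
    (hg : ∀ u, Tendsto (fun n => g n u ω) atTop (𝓝 (Z u))) (hZN : Z (τ ω) = N ω)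
    (hN : 0 < N ω) (hXs : 0 < X s ω) (hXt : 0 < X t ω) (hpos : 0 < Z s ∨ 0 < Z t)
    (hωA : ω ∈ A) (htτ : t ≤ τ ω) :
    Tendsto (fun n => switchIntegrand τ N (g n) X s t A ω) atTop
      (𝓝 (ENNReal.ofReal (Z s) / ENNReal.ofReal (X s ω) *
        (ENNReal.ofReal (N ω) / ENNReal.ofReal (Z t)) *
        ENNReal.ofReal (X t ω) / ENNReal.ofReal (N ω))) := by
  simp only [switchIntegrand, hωA, htτ, if_true]
  have hN' : ENNReal.ofReal (N ω) ≠ 0 := (ENNReal.ofReal_pos.2 hN).ne'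
  have hXs' : ENNReal.ofReal (X s ω) ≠ 0 := (ENNReal.ofReal_pos.2 hXs).ne'
  have hXt' : ENNReal.ofReal (X t ω) ≠ 0 := (ENNReal.ofReal_pos.2 hXt).ne'
  have h1 : Tendsto (fun n => ENNReal.ofReal (g n s ω) / ENNReal.ofReal (X s ω)) atTop
      (𝓝 (ENNReal.ofReal (Z s) / ENNReal.ofReal (X s ω))) :=
    ENNReal.Tendsto.div_const (ENNReal.tendsto_ofReal (hg s)) (Or.inr hXs')
  have h2 : Tendsto (fun n => ENNReal.ofReal (g n (τ ω) ω) / ENNReal.ofReal (g n t ω)) atTop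
      (𝓝 (ENNReal.ofReal (N ω) / ENNReal.ofReal (Z t))) :=
    ENNReal.Tendsto.div (ENNReal.tendsto_ofReal (hZN ▸ hg (τ ω))) (Or.inl hN')
      (ENNReal.tendsto_ofReal (hg t)) (Or.inl ENNReal.ofReal_ne_top)
  have h3 := ENNReal.Tendsto.mul h1 (by
      rcases hpos with h | h
      · left
        exact (ENNReal.div_pos (ENNReal.ofReal_pos.2 h).ne' ENNReal.ofReal_ne_top).ne'
      · right
        exact ENNReal.div_ne_top ENNReal.ofReal_ne_top (ENNReal.ofReal_pos.2 h).ne')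
    h2 (Or.inr (ENNReal.div_ne_top ENNReal.ofReal_ne_top hXs'))
  exact ENNReal.Tendsto.div_const (ENNReal.Tendsto.mul_const h3 (Or.inr ENNReal.ofReal_ne_top))
    (Or.inr hN')

end switchIntegrand

variable [mΩ : MeasurableSpace Ω] {P : Measure Ω}
  {𝒳 : Set (Fin (T + 1) → Ω → ℝ)}

lemma condLExp_le_one_of_forall_setLIntegral_le [IsFiniteMeasure P] {m : MeasurableSpace Ω}
    (hm : m ≤ mΩ) {R : Ω → ℝ≥0∞}
    (hR : ∀ A, MeasurableSet[m] A → ∫⁻ ω in A, R ω ∂P ≤ P A) : P⁻[R | m] ≤ᵐ[P] 1 := by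
  refine ae_le_of_ae_le_trim (hm := hm) ?_
  refine ae_le_of_forall_setLIntegral_le_of_sigmaFinite (measurable_condLExp m P R) ?_
  intro A hA _
  rw [setLIntegral_condLExp_trim hm P R hA]
  simpa [trim_measurableSet_eq hm hA] using hR A hA

/-- Following `G`, switching on `A` at time `s` to `X`, and back to `G` at time `t`. -/
lemma GeneralizedForkConvex.exists_switch_back {ℱ : Filtration (Fin (T + 1)) mΩ}
    (h : GeneralizedForkConvex P ℱ 𝒳) {G X : Fin (T + 1) → Ω → ℝ} (hG : G ∈ 𝒳) (hX : X ∈ 𝒳)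
    {s t : Fin (T + 1)} (hst : s ≤ t) {A : Set Ω} (hA : MeasurableSet[ℱ s] A) :
    ∃ F ∈ 𝒳, ∀ᵐ ω ∂P, (ω ∉ A → ∀ u, F u ω = G u ω) ∧
      (ω ∈ A → 0 < X s ω → 0 < G t ω → ∀ u, t ≤ u →
        F u ω = G s ω / X s ω * (G u ω / G t ω) * X t ω) := by
  obtain ⟨E, hE, hEe⟩ := h.switch_mem X hX G hG G hG t Set.univ MeasurableSet.univ
  obtain ⟨F, hF, hFe⟩ := h.switch_mem G hG E hE G hG s A hA
  refine ⟨F, hF, ?_⟩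
  filter_upwards [ae_all_iff.2 hEe, ae_all_iff.2 hFe] with ω h1 h2
  refine ⟨fun hωA u => ?_, fun hωA hXs hGt u htu => ?_⟩
  · rw [h2 u]
    simp only [switch, hωA, if_false]
    split_ifs with h3 h4
    · rfl
    · field_simp
    · rfl
  · have hEs : E s ω = X s ω := by
      rw [h1 s]
      simp only [switch, Set.mem_univ, if_true]
      -- If `s = t`, the switch back has already happened at `s`, and the value is `G t / G t * X
      -- t`; this uses `0 < G t`.
      rcases hst.eq_or_lt with rfl | hlt
      · simp [hGt, hGt.ne']
      · simp [hlt]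
    have hEu : E u ω = G u ω / G t ω * X t ω := by
      rw [h1 u]
      simp [switch, hGt, not_lt.2 htu]
    rw [h2 u]
    simp only [switch, not_lt.2 (hst.trans htu), hωA, if_true, if_false, hEs, hEu, hXs]
    ring

lemma IsMarket.ae_vanish (h : IsMarket P 𝒳) {X : Fin (T + 1) → Ω → ℝ} (hX : X ∈ 𝒳) :
    ∀ᵐ ω ∂P, ∀ s t, s ≤ t → 0 < X t ω → 0 < X s ω := by
  filter_upwards [h.vanish X hX, h.ae_nonneg hX] with ω h1 h2 s t hst ht
  exact (h2 s).lt_of_ne' fun h0 => ht.ne' (h1 s t hst h0)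

lemma measurable_switchIntegrand {τ : Ω → Fin (T + 1)} {N : Ω → ℝ} {G X : Fin (T + 1) → Ω → ℝ}
    {s t : Fin (T + 1)} {A : Set Ω} (hτ : Measurable τ) (hN : Measurable N)
    (hG : ∀ t, Measurable (G t)) (hX : ∀ t, Measurable (X t)) (hA : MeasurableSet A) :
    Measurable (switchIntegrand τ N G X s t A) := by
  have h1 := (measurable_eval_comp hG hτ).ennreal_ofReal
  exact Measurable.ite hA (Measurable.ite (measurableSet_le measurable_const hτ)
    (((((hG s).ennreal_ofReal.div (hX s).ennreal_ofReal).mul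
      (h1.div (hG t).ennreal_ofReal)).mul (hX t).ennreal_ofReal).div hN.ennreal_ofReal)
    measurable_const) (h1.div hN.ennreal_ofReal)

/-- The integrand is dominated by the value at `τ` of a switched process in the market. Where `X t`
or `G (τ ω)` vanishes it is zero on `A`; elsewhere on `A ∩ {t ≤ τ}`, absorption at zero makes `X s`
and `G t` positive. Here `N` is kept apart from `G` because the limit that defines it need not
belong to the market. -/
lemma lintegral_switchIntegrand_le {τ : Ω → Fin (T + 1)} {N : Ω → ℝ}
    {G X : Fin (T + 1) → Ω → ℝ} {s t : Fin (T + 1)} {A : Set Ω}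
    {ℱ : Filtration (Fin (T + 1)) mΩ} (h : IsMarket P 𝒳)
    (hfork : GeneralizedForkConvex P ℱ 𝒳)
    (hN : ∀ Y ∈ 𝒳, ∫⁻ ω, ENNReal.ofReal (Y (τ ω) ω) / ENNReal.ofReal (N ω) ∂P ≤ 1)
    (hG : G ∈ 𝒳) (hX : X ∈ 𝒳) (hst : s ≤ t) (hA : MeasurableSet[ℱ s] A) :
    ∫⁻ ω, switchIntegrand τ N G X s t A ω ∂P ≤ 1 := by
  obtain ⟨F, hF, hFe⟩ := hfork.exists_switch_back hG hX hst hA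
  refine (lintegral_mono_ae ?_).trans (hN F hF)
  filter_upwards [hFe, h.ae_nonneg hG, h.ae_nonneg hX, h.ae_vanish hG, h.ae_vanish hX]
    with ω hω hG0 hX0 hGv hXv
  unfold switchIntegrand
  split_ifs with hωA htτ
  · rcases (hX0 t).eq_or_lt with hXt | hXt
    · simp [← hXt]
    rcases (hG0 (τ ω)).eq_or_lt with hGτ | hGτ
    · simp [← hGτ]
    have hGt := hGv _ _ htτ hGτ
    have hXs := hXv _ _ hst hXt
    rw [hω.2 hωA hXs hGt _ htτ, ENNReal.ofReal_mul (by have := hG0 s; positivity),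
      ENNReal.ofReal_mul (by have := hG0 s; positivity), ENNReal.ofReal_div_of_pos hXs,
      ENNReal.ofReal_div_of_pos hGt]
  · exact zero_le
  · rw [hω.1 hωA]

/-- In a market with NUPBR, the reciprocal of a suitable limit of wealth processes is a generalized
supermartingale deflator. -/
theorem exists_reciprocalLimit_deflator [IsProbabilityMeasure P]
    {ℱ : Filtration (Fin (T + 1)) mΩ} (h : IsMarket P 𝒳) (hfork : GeneralizedForkConvex P ℱ 𝒳)
    (hne : 𝒳.Nonempty) (hbdd : ∀ t, NUPBR P 𝒳 t) :
    ∃ g : ℕ → Fin (T + 1) → Ω → ℝ, (∀ n, g n ∈ 𝒳) ∧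
      IsGeneralizedSupermartingaleDeflator P ℱ 𝒳 (reciprocalLimit g) := by
  obtain ⟨τ, Y, hτ, hY, hτX, hτY⟩ := h.exists_lifetime hne
    fun X hX Y hY => hfork.exists_midpoint hX hY
  obtain ⟨g, hg, hlim, hnum⟩ := h.exists_numeraire hfork hne hbdd hτ
  refine ⟨g, hg, ?_⟩
  have hgm : ∀ n t, Measurable (g n t) := fun n => (h.process _ (hg n)).measurable
  have hLm : ∀ t, Measurable (limitProcess g t) := fun t =>
    measurable_limitProcess fun n => hgm n t
  have hZm : ∀ t, Measurable (reciprocalLimit g t) := fun t =>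
    measurable_reciprocalLimit fun n => hgm n t
  set N : Ω → ℝ := fun ω => limitProcess g (τ ω) ω
  have hNm : Measurable N := measurable_eval_comp hLm hτ
  have hnum' : ∀ Y ∈ 𝒳, ∫⁻ ω, ENNReal.ofReal (Y (τ ω) ω) / ENNReal.ofReal (N ω) ∂P ≤ 1 := hnum
  have hlim' : ∀ᵐ ω ∂P, ∀ t, Tendsto (fun n => g n t ω) atTop (𝓝 (limitProcess g t ω)) := by
    filter_upwards [hlim] with ω hω t
    obtain ⟨l, hl⟩ := hω t
    rwa [limitProcess, hl.limsup_eq]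
  -- Otherwise one of the countably many quotients `Y t n / N` at `τ` would be infinite on a set of
  -- positive measure.
  have hNpos : ∀ᵐ ω ∂P, 0 < N ω := by
    have hfin : ∀ t n, ∀ᵐ ω ∂P,
        ENNReal.ofReal (Y t n (τ ω) ω) / ENNReal.ofReal (N ω) < ⊤ := fun t n =>
      ae_lt_top ((measurable_eval_comp (h.process _ (hY t n)).measurable hτ).ennreal_ofReal.div
        hNm.ennreal_ofReal) (ne_top_of_le_ne_top ENNReal.one_ne_top (hnum' _ (hY t n)))
    filter_upwards [hτY, ae_all_iff.2 fun t => ae_all_iff.2 (hfin t)] with ω ⟨t, n, hpos⟩ hω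
    by_contra! hcon
    have := hω t n
    rw [ENNReal.ofReal_eq_zero.2 hcon, ENNReal.div_zero (ENNReal.ofReal_pos.2 hpos).ne'] at this
    exact lt_irrefl _ this
  have hfatou : ∀ X ∈ 𝒳, ∀ s t, s ≤ t → ∀ A, MeasurableSet[ℱ s] A →
      ∫⁻ ω, liminf (fun n => switchIntegrand τ N (g n) X s t A ω) atTop ∂P ≤ 1 := by
    intro X hX s t hst A hA
    refine (lintegral_liminf_le fun n => measurable_switchIntegrand hτ hNm (hgm n)
      (h.process X hX).measurable (ℱ.le s A hA)).trans ?_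
    refine liminf_le_of_le (by isBoundedDefault) fun b hb => ?_
    obtain ⟨n, hn⟩ := hb.exists
    exact hn.trans (lintegral_switchIntegrand_le h hfork hnum' (hg n) hX hst hA)
  -- Hold `X` from date `0` to `t` and then switch to `g n`: if the limit vanished at `t` while `X t
  -- > 0`, the return factor would blow up, against the finiteness of the integral.
  have hzero : ∀ X ∈ 𝒳, ∀ t, ∀ᵐ ω ∂P, t ≤ τ ω → 0 < X t ω → 0 < limitProcess g t ω := by
    intro X hX t
    have hfin := ae_lt_top (Measurable.liminf fun n => measurable_switchIntegrand hτ hNm (hgm n)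
      (h.process X hX).measurable (ℱ.le 0 _ MeasurableSet.univ))
      (ne_top_of_le_ne_top ENNReal.one_ne_top
        (hfatou X hX 0 t (Fin.zero_le t) Set.univ MeasurableSet.univ))
    filter_upwards [hfin, hlim', hNpos, h.initial X hX, ae_all_iff.2 fun n => h.initial _ (hg n)]
      with ω h1 h2 h3 h4 h5 htτ hXt
    by_contra! hcon
    have hL0 : limitProcess g 0 ω = 1 := by simp [limitProcess, h5]
    rw [(tendsto_switchIntegrand (N := N) h2 rfl h3 (by rw [h4]; exact one_pos) hXt
      (Or.inl (by rw [hL0]; exact one_pos)) (Set.mem_univ ω) htτ).liminf_eq, hL0, h4,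
      ENNReal.ofReal_eq_zero.2 hcon, ENNReal.div_zero (ENNReal.ofReal_pos.2 h3).ne'] at h1
    simp [ENNReal.top_mul, ENNReal.top_div, hXt] at h1
  have hLpos : ∀ᵐ ω ∂P, ∀ t, t ≤ τ ω → 0 < limitProcess g t ω := by
    filter_upwards [hτY, ae_all_iff.2 fun t => ae_all_iff.2 fun n =>
      ae_all_iff.2 (hzero _ (hY t n)), ae_all_iff.2 fun t => ae_all_iff.2 fun n =>
      h.ae_vanish (hY t n)] with ω ⟨u, n, hu⟩ h1 h2 t ht
    exact h1 u n t ht (h2 u n _ _ ht hu)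
  refine ⟨⟨hZm, fun t => ae_of_all _ fun ω => (reciprocalLimit_pos g t ω).le⟩, ?_, fun X hX =>
    ⟨⟨fun t => (hZm t).mul ((h.process X hX).measurable t), fun t => ?_⟩, fun s t hst => ?_⟩⟩
  · filter_upwards [ae_all_iff.2 fun n => h.initial _ (hg n)] with ω hω
    simp [reciprocalLimit, limitProcess, hω]
  · filter_upwards [h.ae_nonneg hX] with ω hω
    exact mul_nonneg (reciprocalLimit_pos g t ω).le (hω t)
  · refine condLExp_le_one_of_forall_setLIntegral_le (ℱ.le s) fun A hA => ?_
    set R : Ω → ℝ≥0∞ := fun ω => ENNReal.ofReal ((reciprocalLimit g * X) t ω) /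
      ENNReal.ofReal ((reciprocalLimit g * X) s ω) with hR
    have hA' : MeasurableSet A := ℱ.le s A hA
    -- After `τ` the value of the deflator is immaterial, because `X t = 0` makes `R` zero there.
    have hle : ∀ᵐ ω ∂P, A.indicator R ω + Aᶜ.indicator 1 ω ≤
        liminf (fun n => switchIntegrand τ N (g n) X s t A ω) atTop := by
      filter_upwards [hlim', hNpos, hLpos, hτX X hX, h.ae_nonneg hX, h.ae_vanish hX]
        with ω h1 h2 h3 h4 h5 h6
      by_cases hωA : ω ∈ A
      · have hc : ω ∉ Aᶜ := fun hc => hc hωA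
        rw [Set.indicator_of_mem hωA, Set.indicator_of_notMem hc, add_zero]
        rcases (h5 t).eq_or_lt with hXt | hXt
        · simp [hR, ← hXt]
        have htτ : t ≤ τ ω := by
          by_contra! hcon
          exact hXt.ne' (h4 t hcon)
        have hXs := h6 s t hst hXt
        have hLt := h3 t htτ
        have hLs := h3 s (hst.trans htτ)
        rw [(tendsto_switchIntegrand (N := N) h1 rfl h2 hXs hXt (Or.inl hLs) hωA htτ).liminf_eq,
          ← ENNReal.ofReal_div_of_pos hXs, ← ENNReal.ofReal_div_of_pos hLt,
          ← ENNReal.ofReal_mul (by positivity), ← ENNReal.ofReal_mul (by positivity),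
          ← ENNReal.ofReal_div_of_pos h2]
        simp only [hR, Pi.mul_apply, reciprocalLimit, hLt, hLs, if_true]
        rw [← ENNReal.ofReal_div_of_pos (by positivity)]
        refine ENNReal.ofReal_le_ofReal (le_of_eq ?_)
        have := h2.ne'
        field_simp
      · have hc : ω ∈ Aᶜ := hωA
        rw [Set.indicator_of_notMem hωA, Set.indicator_of_mem hc, zero_add, Pi.one_apply]
        have hN' : ENNReal.ofReal (N ω) ≠ 0 := (ENNReal.ofReal_pos.2 h2).ne'
        have ht : Tendsto (fun n => switchIntegrand τ N (g n) X s t A ω) atTop (𝓝 1) := by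
          simp only [switchIntegrand, hωA, if_false]
          rw [← ENNReal.div_self hN' ENNReal.ofReal_ne_top]
          exact ENNReal.Tendsto.div_const (ENNReal.tendsto_ofReal (h1 (τ ω))) (Or.inr hN')
        rw [ht.liminf_eq]
    have htot : ∫⁻ ω in A, R ω ∂P + P Aᶜ ≤ P A + P Aᶜ := by
      calc ∫⁻ ω in A, R ω ∂P + P Aᶜ = ∫⁻ ω, (A.indicator R ω + Aᶜ.indicator 1 ω) ∂P := by
            rw [lintegral_add_right _ (measurable_one.indicator hA'.compl),
              lintegral_indicator hA', lintegral_indicator_one hA'.compl]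
        _ ≤ 1 := (lintegral_mono_ae hle).trans (hfatou X hX s t hst A hA)
        _ = P A + P Aᶜ := by rw [measure_add_measure_compl hA', measure_univ]
    exact (ENNReal.add_le_add_iff_right (measure_ne_top P _)).1 htot

/-! ### Deflators imply NUPBR. -/

/-- A market with a strictly positive generalized supermartingale deflator satisfies NUPBR. -/
theorem IsGeneralizedSupermartingaleDeflator.nupbr [IsProbabilityMeasure P]
    {ℱ : Filtration (Fin (T + 1)) mΩ} (h : IsMarket P 𝒳) {Z : Fin (T + 1) → Ω → ℝ}
    (hZ : IsGeneralizedSupermartingaleDeflator P ℱ 𝒳 Z) (hpos : IsStrictlyPositive P Z)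
    (t : Fin (T + 1)) : NUPBR P 𝒳 t := by
  -- Strict positivity keeps `Z t / Z 0` above some `η > 0` up to small probability. On that event
  -- `X t ≥ M` forces the deflated wealth ratio above `η * M`, and Markov's inequality applies
  -- uniformly in `X`.
  have hsmall : Tendsto (fun n : ℕ => P {ω | Z t ω / Z 0 ω < 1 / ((n : ℝ) + 1)}) atTop (𝓝 0) := by
    have hm : Measurable fun ω => Z t ω / Z 0 ω :=
      (hZ.process.measurable t).div (hZ.process.measurable 0)
    have hanti : Antitone fun n : ℕ => {ω | Z t ω / Z 0 ω < 1 / ((n : ℝ) + 1)} := by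
      intro m n hmn ω (hω : Z t ω / Z 0 ω < 1 / ((n : ℝ) + 1))
      exact hω.trans_le (Nat.one_div_le_one_div hmn)
    have h1 := tendsto_measure_iInter_atTop (μ := P)
      (fun n => (measurableSet_lt hm measurable_const).nullMeasurableSet) hanti
      ⟨0, measure_ne_top _ _⟩
    have h0 : P (⋂ n : ℕ, {ω | Z t ω / Z 0 ω < 1 / ((n : ℝ) + 1)}) = 0 := by
      refine measure_eq_zero_iff_ae_notMem.2 ?_
      filter_upwards [hpos t, hpos 0] with ω ht h0 hω
      obtain ⟨n, hn⟩ := exists_nat_one_div_lt (div_pos ht h0)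
      exact lt_asymm hn (Set.mem_iInter.1 hω n)
    rwa [h0] at h1
  unfold NUPBR BoundedInProbability
  rw [ENNReal.tendsto_nhds_zero]
  intro ε hε
  have hε2 : 0 < ε / 2 := ENNReal.half_pos hε.ne'
  obtain ⟨n, hn⟩ := ((ENNReal.tendsto_nhds_zero.1 hsmall) (ε / 2) hε2).exists
  set η : ℝ := 1 / ((n : ℝ) + 1) with hη
  have hη0 : 0 < η := by positivity
  have hinv : Tendsto (fun M : ℝ => (ENNReal.ofReal (η * M))⁻¹) atTop (𝓝 0) := by
    have := (ENNReal.tendsto_ofReal_atTop.comp (tendsto_id.const_mul_atTop hη0)).inv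
    simpa using this
  filter_upwards [(ENNReal.tendsto_nhds_zero.1 hinv) (ε / 2) hε2, eventually_gt_atTop 0]
    with M hM hM0
  refine iSup₂_le ?_
  rintro _ ⟨X, hX, rfl⟩
  set R : Ω → ℝ≥0∞ := fun ω => ENNReal.ofReal ((Z * X) t ω) / ENNReal.ofReal ((Z * X) 0 ω) with hR
  have hRm : Measurable R :=
    ((hZ.supermartingale X hX).process.measurable t).ennreal_ofReal.div
      ((hZ.supermartingale X hX).process.measurable 0).ennreal_ofReal
  have hR1 : ∫⁻ ω, R ω ∂P ≤ 1 := by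
    rw [← lintegral_condLExp (ℱ.le 0) P R]
    refine (lintegral_mono_ae ((hZ.supermartingale X hX).condLExp_le 0 t (Fin.zero_le t))).trans ?_
    simp
  have hsub : P {ω | M ≤ |X t ω|} ≤
      P ({ω | Z t ω / Z 0 ω < η} ∪ {ω | ENNReal.ofReal (η * M) ≤ R ω}) := by
    refine measure_mono_ae ?_
    filter_upwards [hpos t, hpos 0, h.initial X hX, h.ae_nonneg hX] with ω h1 h2 h3 h4 hω
    have hMX : M ≤ X t ω := by
      have : M ≤ |X t ω| := hω
      rwa [abs_of_nonneg (h4 t)] at this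
    refine or_iff_not_imp_left.2 fun hr => ?_
    have hr' : η ≤ Z t ω / Z 0 ω := not_lt.1 hr
    change ENNReal.ofReal (η * M) ≤ ENNReal.ofReal (Z t ω * X t ω) / ENNReal.ofReal (Z 0 ω * X 0 ω)
    rw [h3, mul_one, ← ENNReal.ofReal_div_of_pos h2]
    refine ENNReal.ofReal_le_ofReal ?_
    calc η * M ≤ Z t ω / Z 0 ω * X t ω := by gcongr
      _ = Z t ω * X t ω / Z 0 ω := by ring
  have hmarkov : P {ω | ENNReal.ofReal (η * M) ≤ R ω} ≤ (ENNReal.ofReal (η * M))⁻¹ := by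
    refine (meas_ge_le_lintegral_div hRm.aemeasurable
      (ENNReal.ofReal_pos.2 (by positivity)).ne' ENNReal.ofReal_ne_top).trans ?_
    rw [← one_div]
    exact ENNReal.div_le_div_right hR1 _
  calc P {ω | M ≤ |X t ω|} ≤ P {ω | Z t ω / Z 0 ω < η} +
        P {ω | ENNReal.ofReal (η * M) ≤ R ω} := hsub.trans (measure_union_le _ _)
    _ ≤ ε / 2 + ε / 2 := add_le_add hn (hmarkov.trans hM)
    _ = ε := ENNReal.add_halves ε

lemma isGeneralizedSupermartingaleDeflator_one_of_empty [IsProbabilityMeasure P]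
    (ℱ : Filtration (Fin (T + 1)) mΩ) :
    IsGeneralizedSupermartingaleDeflator P ℱ (∅ : Set (Fin (T + 1) → Ω → ℝ)) 1 where
  process := ⟨fun _ => measurable_one, fun _ => ae_of_all _ fun _ => zero_le_one⟩
  initial := ae_of_all _ fun _ => le_rfl
  supermartingale := fun _ hX => hX.elim

end DiscreteMarket

/-! ### The two equivalences. -/

theorem mainTheorem1 {Ω : Type*} [mΩ : MeasurableSpace Ω] (P : Measure Ω) [IsProbabilityMeasure P]
    (T : ℕ) (ℱ : Filtration (Fin (T + 1)) mΩ) (𝒳 : Set (Fin (T + 1) → Ω → ℝ))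
    (h_market : DiscreteMarket.IsMarket P 𝒳)
    (h_fork : DiscreteMarket.GeneralizedForkConvex P ℱ 𝒳) :
    ((∀ t, DiscreteMarket.NUPBR P 𝒳 t) ↔
      ∃ Z : Fin (T + 1) → Ω → ℝ,
        DiscreteMarket.IsGeneralizedSupermartingaleDeflator P ℱ 𝒳 Z ∧
          DiscreteMarket.IsStrictlyPositive P Z) ∧
    (DiscreteMarket.IsAdaptedMarket ℱ 𝒳 →
      ((∀ t, DiscreteMarket.NUPBR P 𝒳 t) ↔
        ∃ Z : Fin (T + 1) → Ω → ℝ,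
          DiscreteMarket.IsSupermartingaleDeflator P ℱ 𝒳 Z ∧
            DiscreteMarket.IsStrictlyPositive P Z)) := by
  have key : (∀ t, DiscreteMarket.NUPBR P 𝒳 t) → ∃ Z : Fin (T + 1) → Ω → ℝ,
      DiscreteMarket.IsGeneralizedSupermartingaleDeflator P ℱ 𝒳 Z ∧
        DiscreteMarket.IsStrictlyPositive P Z ∧
        (DiscreteMarket.IsAdaptedMarket ℱ 𝒳 → Adapted ℱ Z) := by
    intro h
    -- A market may be empty; then there is no sequence to take a limit of, and the constant `1` is
    -- a deflator.
    rcases 𝒳.eq_empty_or_nonempty with rfl | hne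
    · exact ⟨1, DiscreteMarket.isGeneralizedSupermartingaleDeflator_one_of_empty ℱ,
        fun _ => ae_of_all _ fun _ => zero_lt_one, fun _ _ => measurable_const⟩
    · obtain ⟨g, hg, hZ⟩ := DiscreteMarket.exists_reciprocalLimit_deflator h_market h_fork hne h
      exact ⟨_, hZ, fun t => ae_of_all _ (DiscreteMarket.reciprocalLimit_pos g t), fun hadapted t =>
        DiscreteMarket.measurable_reciprocalLimit fun n => hadapted _ (hg n) t⟩
  refine ⟨⟨fun h => ?_, ?_⟩, fun hadapted => ⟨fun h => ?_, ?_⟩⟩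
  · obtain ⟨Z, hZ, hpos, -⟩ := key h
    exact ⟨Z, hZ, hpos⟩
  · rintro ⟨Z, hZ, hpos⟩ t
    exact hZ.nupbr h_market hpos t
  · obtain ⟨Z, hZ, hpos, hZa⟩ := key h
    exact ⟨Z, ⟨hZ, hZa hadapted⟩, hpos⟩
  · rintro ⟨Z, hZ, hpos⟩ t
    exact hZ.toIsGeneralizedSupermartingaleDeflator.nupbr h_market hpos t
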